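/- For a regular closed plane curve $f$ with arc-length parameter $s$, unit tangent $\tau=\partial_s f$ and unit normal $\nu$ ($\tau$ rotated counter-clockwise by $\pi/2$), let $L$ be its length, $\kappa=\partial_s^2 f\cdot\nu$ its curvature, $\tilde\kappa=\kappa-\frac1L\int_0^L\kappa\,ds$, $n=\frac1{2\pi}\int_0^L\kappa\,ds$ its rotation number, $A=-\frac12\int_0^L f\cdot\nu\,ds$ its signed area, and $I_{-1}=1-\frac{4\pi nA}{L^2}$ its isoperimetric deficit. Consider the flows $\partial_t f=\left(\tilde\kappa-\frac gL\right)\nu$ (with $\partial_t$ taken at a fixed parameter $u\in\mathbb R/\mathbb Z$ of the curve) with - (AP) $g=0$; - (LP) $g=L\left(\int_0^L\kappa\,ds\right)^{-1}\int_0^L\tilde\kappa^2\,ds$; - (JP) $g=\frac{L^2}{2A}-\int_0^L\kappa\,ds$. Let $0<T\le\infty$ and let $f$ be a classical solution of (AP), (LP) or (JP) on $[0,T)$: a family of regular closed $C^2$ curves such that $f,\partial_u f,\partial_u^2 f$ are continuous on $\mathbb R/\mathbb Z\times[0,T)$, and $\partial_t f$ exists and satisfies the equation for $0<t<T$. Assume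 that the initial curve is smooth, has rotation number $n\ge1$, and satisfies $A(0)>0$. Then $A$, $L^2$ and $I_{-1}$ have the following properties for all $t\in(0,T)$ (the existence of the derivatives written being part of the claim). 1. For (AP): $\frac{dA}{dt}=0$, $A(t)=A(0)>0$, $\frac{dL^2}{dt}\le0$, $\frac{dI_{-1}}{dt}\le0$. 2. For (LP): $\frac{dA}{dt}\ge0$, $A(t)\ge A(0)>0$, $\frac{dL^2}{dt}=0$, $\frac{dI_{-1}}{dt}\le0$. 3. For (JP): $A(t)>0$, $\frac{dI_{-1}}{dt}\le0$. 4. For each of the three flows: $1-n\le I_{-1}(t)\le I_{-1}(0)$, and in other words $4\pi\le\frac{L(t)^2}{A(t)}\le\frac{L(0)^2}{A(0)}$. -/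

import Mathlib

open scoped ContDiff

noncomputable section

namespace PlaneCurve

/-! The Euclidean plane is `ℂ`, and a closed plane curve is given by a `1`-periodic map `γ : ℝ → ℂ`
in an arbitrary regular parameter `u`. The arc-length element is `ds = ‖γ'(u)‖ du`. -/

/-- The arc-length derivative `∂ₛ h = ‖γ'‖⁻¹ ∂ᵤ h` of a function `h` along `γ`. -/
def arcDeriv (γ h : ℝ → ℂ) (u : ℝ) : ℂ := ‖deriv γ u‖⁻¹ • deriv h u

/-- The integral `∫₀ᴸ h ds` over one period of `γ`. -/
def arcIntegral (γ : ℝ → ℂ) (h : ℝ → ℝ) : ℝ := ∫ u in (0 : ℝ)..1, h u * ‖deriv γ u‖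

/-- The total length `L`. -/
def length (γ : ℝ → ℂ) : ℝ := ∫ u in (0 : ℝ)..1, ‖deriv γ u‖

/-- The unit tangent vector `τ = ∂ₛ f`. -/
def tangent (γ : ℝ → ℂ) : ℝ → ℂ := arcDeriv γ γ

/-- The curvature vector `∂ₛ² f`. -/
def curvatureVector (γ : ℝ → ℂ) : ℝ → ℂ := arcDeriv γ (tangent γ)

/-- The unit normal vector: `τ` rotated counter-clockwise by `π / 2`. -/
def normal (γ : ℝ → ℂ) (u : ℝ) : ℂ := Complex.I * tangent γ u

/-- The signed curvature `κ`. -/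
def curvature (γ : ℝ → ℂ) (u : ℝ) : ℝ := inner ℝ (curvatureVector γ u) (normal γ u)

/-- The total curvature `∫₀ᴸ κ ds`. -/
def totalCurvature (γ : ℝ → ℂ) : ℝ := arcIntegral γ (curvature γ)

/-- The deviation `κ - (1 / L) ∫₀ᴸ κ ds` of the curvature from its mean. -/
def curvatureDev (γ : ℝ → ℂ) (u : ℝ) : ℝ := curvature γ u - 1 / length γ * totalCurvature γ

/-- The rotation number `(1 / 2π) ∫₀ᴸ κ ds`. -/
def rotationNumber (γ : ℝ → ℂ) : ℝ := 1 / (2 * Real.pi) * totalCurvature γ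

/-- The signed enclosed area `A = - (1 / 2) ∫₀ᴸ f · ν ds`. -/
def area (γ : ℝ → ℂ) : ℝ := -(1 / 2) * arcIntegral γ (fun u => inner ℝ (γ u) (normal γ u))

/-- The isoperimetric deficit `I₋₁ = 1 - 4 n π A / L²`, with `n` the rotation number. -/
def isoDeficit (γ : ℝ → ℂ) : ℝ :=
  1 - 4 * rotationNumber γ * Real.pi * area γ / length γ ^ 2

/-- The non-local term of the area-preserving flow. -/
def gAP (_γ : ℝ → ℂ) : ℝ := 0

/-- The non-local term of the length-preserving flow. -/
def gLP (γ : ℝ → ℂ) : ℝ :=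
  length γ * (totalCurvature γ)⁻¹ * arcIntegral γ (fun u => curvatureDev γ u ^ 2)

/-- The non-local term of the Jiang-Pan flow. -/
def gJP (γ : ℝ → ℂ) : ℝ := length γ ^ 2 / (2 * area γ) - totalCurvature γ

/-- `X` (with `X t` the curve at time `t`) is a classical solution on `[0, T)`, `T ≤ ∞`, of
`∂ₜ f = (κ - (1 / L) ∫ κ ds - g / L) ν`: a family of regular closed `C²` curves such that `X`, `∂ᵤ X`
and `∂ᵤ² X` are continuous up to the initial time, `∂ₜ X` exists for `0 < t < T`, and the equation
holds there. The time derivative is taken at a fixed value of the parameter `u`. -/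
structure IsClassicalSolution (g : (ℝ → ℂ) → ℝ) (T : EReal) (X : ℝ → ℝ → ℂ) : Prop where
  periodic : ∀ t : ℝ, 0 ≤ t → (t : EReal) < T → Function.Periodic (X t) 1
  contDiff : ∀ t : ℝ, 0 ≤ t → (t : EReal) < T → ContDiff ℝ 2 (X t)
  regular : ∀ t : ℝ, 0 ≤ t → (t : EReal) < T → ∀ u : ℝ, deriv (X t) u ≠ 0
  continuousOn : ContinuousOn (fun p : ℝ × ℝ => X p.1 p.2)
    {p | 0 ≤ p.1 ∧ (p.1 : EReal) < T}
  continuousOn_deriv : ContinuousOn (fun p : ℝ × ℝ => deriv (X p.1) p.2)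
    {p | 0 ≤ p.1 ∧ (p.1 : EReal) < T}
  continuousOn_deriv_two : ContinuousOn (fun p : ℝ × ℝ => deriv (deriv (X p.1)) p.2)
    {p | 0 ≤ p.1 ∧ (p.1 : EReal) < T}
  equation : ∀ t : ℝ, 0 < t → (t : EReal) < T → ∀ u : ℝ,
    HasDerivAt (fun t' => X t' u)
      ((curvatureDev (X t) u - g (X t) / length (X t)) • normal (X t) u) t

end PlaneCurve

end

open PlaneCurve

open MeasureTheory Filter Topology intervalIntegral

/-! Write `K` for the total curvature, `E` for the integral of the squared curvature deviation, and
`V` for the normal speed `κ̃ - g / L`. The first variations are `A' = -∫ V ds = g`, since `κ̃` has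
mean zero, and `L' = -∫ κ V ds = g K / L - E`. The total curvature is continuous in time with values
in `2πℤ`, hence constant. Since `L L' = g K - L E`, the deficit is nonincreasing as soon as `g (L² -
2 A K) + 2 A L E ≥ 0`. For (AP) this quantity is `2 A L E`; for (LP) it is `L³ E / K`; for (JP) it
is `(L² - 2 A K)² / (2 A) + 2 A L E`. The lower bound `1 - n` is the isoperimetric inequality `4πA ≤
L²` for signed area (`four_pi_mul_area_le`).

Two points need care. The solution is only `C²` in space, so the velocity need not be differentiable
along the curve, and length and area cannot be differentiated under the integral in the usual way.
Instead, increments of area are computed exactly by polarisation, and increments of length are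
bounded on both sides by convexity of the norm (`length_sub_length_ge`). In both cases only `X s - X
t` appears undifferentiated, and dominated convergence applies (`tendsto_integral_inner_slope`). The
second point is that the (JP) term is singular where the area vanishes, so positivity of the area
comes first, from an argument at the first zero (`area_pos_of_gJP`). -/

namespace PlaneCurve

/-- The real inner product of the plane in coordinates. -/
theorem inner_eq_re_im (z w : ℂ) : inner ℝ z w = z.re * w.re + z.im * w.im := by
  simp [Complex.inner, Complex.mul_re]
  ring

/-! ### Geometry of a single closed curve: Frenet equation, curvature, rotation number. -/

section Curve

variable {γ : ℝ → ℂ}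

theorem hasDerivAt_of_contDiff_two (hγ : ContDiff ℝ 2 γ) (u : ℝ) :
    HasDerivAt γ (deriv γ u) u :=
  (hγ.differentiable (by norm_num) u).hasDerivAt

theorem contDiff_deriv_of_contDiff_two (hγ : ContDiff ℝ 2 γ) : ContDiff ℝ 1 (deriv γ) := by
  have h : ContDiff ℝ (1 + 1) γ := by simpa [one_add_one_eq_two] using hγ
  exact (contDiff_succ_iff_deriv.1 h).2.2

theorem hasDerivAt_deriv_of_contDiff_two (hγ : ContDiff ℝ 2 γ) (u : ℝ) :
    HasDerivAt (deriv γ) (deriv (deriv γ) u) u :=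
  ((contDiff_deriv_of_contDiff_two hγ).differentiable (by norm_num) u).hasDerivAt

theorem continuous_deriv_of_contDiff_two (hγ : ContDiff ℝ 2 γ) : Continuous (deriv γ) :=
  (contDiff_deriv_of_contDiff_two hγ).continuous

theorem continuous_deriv_deriv_of_contDiff_two (hγ : ContDiff ℝ 2 γ) :
    Continuous (deriv (deriv γ)) :=
  (contDiff_deriv_of_contDiff_two hγ).continuous_deriv (by norm_num)

theorem periodic_deriv {c : ℝ} (hp : Function.Periodic γ c) : Function.Periodic (deriv γ) c := by
  intro u
  rw [← deriv_comp_add_const]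
  congr 1
  exact funext hp

theorem periodic_tangent (hp : Function.Periodic γ 1) : Function.Periodic (tangent γ) 1 := by
  intro u
  simp only [tangent, arcDeriv, periodic_deriv hp u]

/-- The rate of turning `⟨γ'', i γ'⟩ / ‖γ'‖²` of the tangent in the parameter of the curve. -/
noncomputable def turningRate (γ : ℝ → ℂ) (u : ℝ) : ℝ :=
  inner ℝ (deriv (deriv γ) u) (Complex.I * deriv γ u) / ‖deriv γ u‖ ^ 2

/-- Frenet equation in the parameter `u`. Normalising `γ'` removes the tangential part of `γ''`; in
coordinates this is a polynomial identity modulo `‖γ'‖² = re² + im²`. -/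
theorem hasDerivAt_tangent (hγ : ContDiff ℝ 2 γ) (hr : ∀ u, deriv γ u ≠ 0) (u : ℝ) :
    HasDerivAt (tangent γ) (turningRate γ u • normal γ u) u := by
  have h1 := hasDerivAt_deriv_of_contDiff_two hγ u
  have hn : ‖deriv γ u‖ ≠ 0 := norm_ne_zero_iff.2 (hr u)
  have h2 : HasDerivAt (fun v => ‖deriv γ v‖)
      (inner ℝ (deriv γ u) (deriv (deriv γ) u) / ‖deriv γ u‖) u := by
    have h3 := (h1.norm_sq).sqrt (by positivity)
    simp only [Real.sqrt_sq (norm_nonneg _)] at h3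
    convert h3 using 1
    field_simp
  have h4 : HasDerivAt (tangent γ) (‖deriv γ u‖⁻¹ • deriv (deriv γ) u +
      (-(inner ℝ (deriv γ u) (deriv (deriv γ) u) / ‖deriv γ u‖) / ‖deriv γ u‖ ^ 2) •
        deriv γ u) u := (h2.inv hn).smul h1
  refine h4.congr_deriv ?_
  have hsq : ‖deriv γ u‖ ^ 2 = (deriv γ u).re ^ 2 + (deriv γ u).im ^ 2 := by
    rw [Complex.sq_norm, Complex.normSq_apply]; ring
  simp only [turningRate, normal, tangent, arcDeriv, inner_eq_re_im]
  generalize ‖deriv γ u‖ = r at *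
  generalize deriv γ u = z at *
  generalize deriv (deriv γ) u = w at *
  apply Complex.ext
  · simp only [Complex.add_re, Complex.smul_re, Complex.mul_re, Complex.mul_im, Complex.smul_im,
      Complex.I_re, Complex.I_im, smul_eq_mul]
    field_simp
    rw [hsq]; ring
  · simp only [Complex.add_im, Complex.smul_re, Complex.mul_re, Complex.mul_im, Complex.smul_im,
      Complex.I_re, Complex.I_im, smul_eq_mul]
    field_simp
    rw [hsq]; ring

theorem norm_tangent (hr : ∀ u, deriv γ u ≠ 0) (u : ℝ) : ‖tangent γ u‖ = 1 := by
  have hn : ‖deriv γ u‖ ≠ 0 := norm_ne_zero_iff.2 (hr u)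
  simp [tangent, arcDeriv, hn]

theorem norm_normal (hr : ∀ u, deriv γ u ≠ 0) (u : ℝ) : ‖normal γ u‖ = 1 := by
  simp [normal, norm_tangent hr]

theorem norm_smul_tangent (hr : ∀ u, deriv γ u ≠ 0) (u : ℝ) :
    ‖deriv γ u‖ • tangent γ u = deriv γ u := by
  have hn : ‖deriv γ u‖ ≠ 0 := norm_ne_zero_iff.2 (hr u)
  rw [tangent, arcDeriv, smul_smul, mul_inv_cancel₀ hn, one_smul]

theorem norm_smul_normal (hr : ∀ u, deriv γ u ≠ 0) (u : ℝ) :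
    ‖deriv γ u‖ • normal γ u = Complex.I * deriv γ u := by
  rw [normal, ← mul_smul_comm, norm_smul_tangent hr]

theorem curvature_eq (hγ : ContDiff ℝ 2 γ) (hr : ∀ u, deriv γ u ≠ 0) (u : ℝ) :
    curvature γ u = turningRate γ u / ‖deriv γ u‖ := by
  rw [curvature, curvatureVector, arcDeriv, (hasDerivAt_tangent hγ hr u).deriv,
    inner_smul_left, inner_smul_left, real_inner_self_eq_norm_sq, norm_normal hr]
  simp
  ring

theorem curvature_mul_norm (hγ : ContDiff ℝ 2 γ) (hr : ∀ u, deriv γ u ≠ 0) (u : ℝ) :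
    curvature γ u * ‖deriv γ u‖ = turningRate γ u := by
  rw [curvature_eq hγ hr, div_mul_cancel₀ _ (norm_ne_zero_iff.2 (hr u))]

theorem continuous_turningRate (hγ : ContDiff ℝ 2 γ) (hr : ∀ u, deriv γ u ≠ 0) :
    Continuous (turningRate γ) := by
  have h1 := continuous_deriv_of_contDiff_two hγ
  have h2 := continuous_deriv_deriv_of_contDiff_two hγ
  exact (h2.inner (continuous_const.mul h1)).div₀ (h1.norm.pow 2)
    fun u => pow_ne_zero _ (norm_ne_zero_iff.2 (hr u))

theorem continuous_curvature (hγ : ContDiff ℝ 2 γ) (hr : ∀ u, deriv γ u ≠ 0) :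
    Continuous (curvature γ) := by
  rw [funext (curvature_eq hγ hr)]
  exact (continuous_turningRate hγ hr).div₀ (continuous_deriv_of_contDiff_two hγ).norm
    fun u => norm_ne_zero_iff.2 (hr u)

theorem continuous_tangent (hγ : ContDiff ℝ 2 γ) (hr : ∀ u, deriv γ u ≠ 0) :
    Continuous (tangent γ) :=
  continuous_iff_continuousAt.2 fun u => (hasDerivAt_tangent hγ hr u).continuousAt

theorem continuous_normal (hγ : ContDiff ℝ 2 γ) (hr : ∀ u, deriv γ u ≠ 0) :
    Continuous (normal γ) :=
  continuous_const.mul (continuous_tangent hγ hr)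

theorem totalCurvature_eq (hγ : ContDiff ℝ 2 γ) (hr : ∀ u, deriv γ u ≠ 0) :
    totalCurvature γ = ∫ u in (0 : ℝ)..1, turningRate γ u := by
  simp only [totalCurvature, arcIntegral, curvature_mul_norm hγ hr]

/-- The speed cancels against the normalisation of the normal, leaving an integrand bilinear in the
curve and its derivative; the polarisation in the first variation of area rests on this form. -/
theorem area_eq (hr : ∀ u, deriv γ u ≠ 0) :
    area γ = ∫ u in (0 : ℝ)..1, inner ℝ (γ u) (-(Complex.I / 2) * deriv γ u) := by
  rw [area, arcIntegral, ← intervalIntegral.integral_const_mul]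
  congr 1
  ext u
  have h : inner ℝ (γ u) (normal γ u) * ‖deriv γ u‖ = inner ℝ (γ u) (Complex.I * deriv γ u) := by
    rw [← norm_smul_normal hr u, inner_smul_right, mul_comm]
  rw [h]
  simp
  ring

theorem length_pos (hγ : ContDiff ℝ 2 γ) (hr : ∀ u, deriv γ u ≠ 0) : 0 < length γ :=
  intervalIntegral_pos_of_pos ((continuous_deriv_of_contDiff_two hγ).norm.intervalIntegrable _ _)
    (fun u => norm_pos_iff.2 (hr u)) one_pos

/-- The total curvature of a closed curve is an integer multiple of `2π`. -/
theorem exists_totalCurvature_eq (hγ : ContDiff ℝ 2 γ) (hr : ∀ u, deriv γ u ≠ 0)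
    (hp : Function.Periodic γ 1) : ∃ m : ℤ, totalCurvature γ = 2 * Real.pi * m := by
  set Θ : ℝ → ℝ := fun u => ∫ v in (0 : ℝ)..u, turningRate γ v with hΘ
  have hc := continuous_turningRate hγ hr
  have hΘd : ∀ u, HasDerivAt Θ (turningRate γ u) u := fun u =>
    intervalIntegral.integral_hasDerivAt_right (hc.intervalIntegrable _ _)
      (hc.stronglyMeasurableAtFilter _ _) hc.continuousAt
  -- `Θ` is the angle through which the tangent has turned. Rotating the tangent back by `Θ` gives a
  -- constant, so closedness forces `exp (-i Θ 1) = 1`.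
  have hd : ∀ u, HasDerivAt (fun v => tangent γ v * Complex.exp (-(Θ v * Complex.I))) 0 u := by
    intro u
    have h1 := (((hΘd u).ofReal_comp.mul_const Complex.I).neg).cexp
    refine ((hasDerivAt_tangent hγ hr u).mul h1).congr_deriv ?_
    simp [normal]
    ring
  have hconst := is_const_of_deriv_eq_zero (fun u => (hd u).differentiableAt)
    (fun u => (hd u).deriv) 1 0
  have h0 : Θ 0 = 0 := by simp [hΘ]
  have h1 : Θ 1 = totalCurvature γ := (totalCurvature_eq hγ hr).symm
  have htan : tangent γ 1 = tangent γ 0 := by simpa using periodic_tangent hp 0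
  have hne : tangent γ 0 ≠ 0 := by
    rw [← norm_ne_zero_iff, norm_tangent hr]; exact one_ne_zero
  simp only [h0, h1, htan] at hconst
  have hexp : Complex.exp (-(totalCurvature γ * Complex.I)) = 1 := by
    refine mul_left_cancel₀ hne (hconst.trans ?_)
    simp
  obtain ⟨m, hm⟩ := Complex.exp_eq_one_iff.1 hexp
  refine ⟨-m, ?_⟩
  have := congrArg Complex.im hm
  simp at this
  push_cast
  linarith

end Curve

/-- Integration by parts for `1`-periodic plane-valued functions. -/
theorem integral_inner_deriv_of_periodic {f g f' g' : ℝ → ℂ} (hf : ∀ u, HasDerivAt f (f' u) u)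
    (hg : ∀ u, HasDerivAt g (g' u) u) (hf' : Continuous f') (hg' : Continuous g')
    (hfp : f 1 = f 0) (hgp : g 1 = g 0) :
    ∫ u in (0 : ℝ)..1, inner ℝ (f u) (g' u) = -∫ u in (0 : ℝ)..1, inner ℝ (f' u) (g u) := by
  have hfc : Continuous f := continuous_iff_continuousAt.2 fun u => (hf u).continuousAt
  have hgc : Continuous g := continuous_iff_continuousAt.2 fun u => (hg u).continuousAt
  have h := intervalIntegral.integral_eq_sub_of_hasDerivAt (a := 0) (b := 1)
    (fun u _ => (hf u).inner ℝ (hg u))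
    (((hfc.inner hg').add (hf'.inner hgc)).intervalIntegrable _ _)
  rw [intervalIntegral.integral_add ((hfc.inner hg').intervalIntegrable _ _)
    ((hf'.inner hgc).intervalIntegrable _ _), hfp, hgp, sub_self] at h
  linarith

/-! ### The isoperimetric inequality, by E. Schmidt's comparison with a circle. -/

section Isoperimetric

variable {γ : ℝ → ℂ}

/-- Substituting `v = x / r` gives the area of a half disc. Only the end values of `x` matter, so
`x` need not be monotone. -/
theorem integral_circle_arc {r a b : ℝ} (hr : 0 < r) {x x' : ℝ → ℝ}
    (hx : ∀ u, HasDerivAt x (x' u) u) (hx' : Continuous x') (ha : x a = -r) (hb : x b = r) :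
    ∫ u in a..b, r * √(1 - (x u / r) ^ 2) * x' u = Real.pi * r ^ 2 / 2 := by
  have h := intervalIntegral.integral_comp_mul_deriv (a := a) (b := b)
    (f := fun u => x u / r) (f' := fun u => x' u / r) (g := fun v => √(1 - v ^ 2))
    (fun u _ => (hx u).div_const r) (hx'.div_const r).continuousOn (by fun_prop)
  simp only [Function.comp_apply, ha, hb, neg_div, div_self hr.ne', integral_sqrt_one_sub_sq] at h
  rw [show Real.pi * r ^ 2 / 2 = r ^ 2 * (Real.pi / 2) by ring, ← h,
    ← intervalIntegral.integral_const_mul]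
  congr 1
  ext u
  field_simp

/-- Cauchy–Schwarz in the plane; the defect is the square of `a * d - b * c`. -/
theorem mul_add_mul_le_of_sq_add_sq {a b c d r s : ℝ} (hr : 0 ≤ r) (hs : 0 ≤ s)
    (h1 : a ^ 2 + b ^ 2 = r ^ 2) (h2 : c ^ 2 + d ^ 2 = s ^ 2) : a * c + b * d ≤ r * s := by
  refine abs_le_of_sq_le_sq' ?_ (mul_nonneg hr hs) |>.2
  rw [mul_pow, ← h1, ← h2]
  nlinarith [sq_nonneg (a * d - b * c)]

/-- The area of a closed curve as the integral of `(x - c) dy`. -/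
theorem area_eq_integral_re_mul_im (hγ : ContDiff ℝ 2 γ) (hr : ∀ u, deriv γ u ≠ 0)
    (hp : Function.Periodic γ 1) (c : ℝ) :
    area γ = ∫ u in (0 : ℝ)..1, ((γ u).re - c) * (deriv γ u).im := by
  have hd := hasDerivAt_of_contDiff_two hγ
  have hc := continuous_deriv_of_contDiff_two hγ
  have hre : ∀ u, HasDerivAt (fun v => (γ v).re) (deriv γ u).re u := fun u =>
    (Complex.reCLM.hasFDerivAt (x := γ u)).comp_hasDerivAt u (hd u)
  have him : ∀ u, HasDerivAt (fun v => (γ v).im) (deriv γ u).im u := fun u =>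
    (Complex.imCLM.hasFDerivAt (x := γ u)).comp_hasDerivAt u (hd u)
  have hcre : Continuous fun u => (deriv γ u).re := Complex.continuous_re.comp hc
  have hcim : Continuous fun u => (deriv γ u).im := Complex.continuous_im.comp hc
  have hγre : Continuous fun u => (γ u).re := Complex.continuous_re.comp hγ.continuous
  have hγim : Continuous fun u => (γ u).im := Complex.continuous_im.comp hγ.continuous
  have h10 : γ 1 = γ 0 := by simpa using hp 0
  -- This periodic primitive is chosen so that its derivative, added to `(x dy - y dx) / 2`, gives
  -- `(x - c) dy`.
  have h := intervalIntegral.integral_eq_sub_of_hasDerivAt (a := 0) (b := 1)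
    (f := fun u => ((γ u).re / 2 - c) * (γ u).im)
    (f' := fun u => (deriv γ u).re / 2 * (γ u).im + ((γ u).re / 2 - c) * (deriv γ u).im)
    (fun u _ => (((hre u).div_const 2).sub_const c).mul (him u))
    (Continuous.intervalIntegrable (by fun_prop) _ _)
  rw [h10, sub_self] at h
  refine (area_eq hr).trans ((add_zero _).symm.trans ((congrArg _ h.symm).trans ?_))
  rw [← intervalIntegral.integral_add]
  · congr 1
    ext u
    simp
    ring
  · exact Continuous.intervalIntegrable (hγ.continuous.inner (continuous_const.mul hc)) _ _
  · exact Continuous.intervalIntegrable (by fun_prop) _ _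

/-- A periodic continuous function attains its extrema, the maximum within one period after a
minimum. -/
theorem exists_min_max_of_periodic {x : ℝ → ℝ} (hx : Continuous x) (hp : Function.Periodic x 1) :
    ∃ a b, a ≤ b ∧ b ≤ a + 1 ∧ ∀ u, x a ≤ x u ∧ x u ≤ x b := by
  obtain ⟨a, -, ha⟩ := isCompact_Icc.exists_isMinOn (Set.nonempty_Icc.2 (zero_le_one' ℝ))
    hx.continuousOn
  have ha' : ∀ u, x a ≤ x u := fun u => by
    obtain ⟨v, hv, hv'⟩ := hp.exists_mem_Ico₀ one_pos u
    rw [hv']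
    exact ha ⟨hv.1, hv.2.le⟩
  obtain ⟨b, hb, hb'⟩ := isCompact_Icc.exists_isMaxOn
    (Set.nonempty_Icc.2 (le_add_of_nonneg_right (zero_le_one' ℝ) : a ≤ a + 1)) hx.continuousOn
  refine ⟨a, b, hb.1, hb.2, fun u => ⟨ha' u, ?_⟩⟩
  obtain ⟨v, hv, hv'⟩ := hp.exists_mem_Ico one_pos u a
  rw [hv']
  exact hb' ⟨hv.1, hv.2.le⟩

/-- The isoperimetric inequality for closed plane curves and their signed area, by comparison with
a circle having the same projection to the first axis. -/
theorem four_pi_mul_area_le (hγ : ContDiff ℝ 2 γ) (hr : ∀ u, deriv γ u ≠ 0)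
    (hp : Function.Periodic γ 1) : 4 * Real.pi * area γ ≤ length γ ^ 2 := by
  have hd := hasDerivAt_of_contDiff_two hγ
  have hc := continuous_deriv_of_contDiff_two hγ
  have hcre : Continuous fun u => (deriv γ u).re := Complex.continuous_re.comp hc
  have hcim : Continuous fun u => (deriv γ u).im := Complex.continuous_im.comp hc
  have hγre : Continuous fun u => (γ u).re := Complex.continuous_re.comp hγ.continuous
  have hpre : Function.Periodic (fun u => (γ u).re) 1 := fun u => by simp only [hp u]
  obtain ⟨a, b, hab, hba, hmm⟩ := exists_min_max_of_periodic hγre hpre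
  set c := ((γ a).re + (γ b).re) / 2 with hcdef
  set r := ((γ b).re - (γ a).re) / 2 with hrdef
  have hr0 : 0 ≤ r := by have := (hmm a).2; linarith
  set x : ℝ → ℝ := fun u => (γ u).re - c with hxdef
  have hx : ∀ u, HasDerivAt x (deriv γ u).re u := fun u =>
    ((Complex.reCLM.hasFDerivAt (x := γ u)).comp_hasDerivAt u (hd u)).sub_const c
  have hxc : Continuous x := hγre.sub continuous_const
  have hxa : x a = -r := by simp only [hxdef, hcdef, hrdef]; ring
  have hxb : x b = r := by simp only [hxdef, hcdef, hrdef]; ring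
  have hxa' : x (a + 1) = -r := by rw [← hxa]; simp only [hxdef, hp a]
  have hxabs : ∀ u, x u ^ 2 ≤ r ^ 2 := fun u => by
    have h1 := hmm u
    apply sq_le_sq'
    · simp only [hxdef, hcdef, hrdef]; linarith
    · simp only [hxdef, hcdef, hrdef]; linarith
  have harea : area γ = ∫ u in a..(a + 1), x u * (deriv γ u).im := by
    rw [area_eq_integral_re_mul_im hγ hr hp c]
    have hper : Function.Periodic (fun u => x u * (deriv γ u).im) 1 := fun u => by
      simp only [hxdef, hp u, periodic_deriv hp u]
    have := hper.intervalIntegral_add_eq 0 a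
    simpa using this
  have hlen : length γ = ∫ u in a..(a + 1), ‖deriv γ u‖ := by
    have hper : Function.Periodic (fun u => ‖deriv γ u‖) 1 := fun u => by
      simp only [periodic_deriv hp u]
    have := hper.intervalIntegral_add_eq 0 a
    simpa [length] using this
  -- If `r = 0` the curve lies on a vertical line and its signed area vanishes.
  rcases hr0.eq_or_lt with h0 | hrpos
  · have hx0 : ∀ u, x u = 0 := fun u => by
      have := hxabs u
      rw [← h0] at this
      nlinarith [sq_nonneg (x u)]
    have : area γ = 0 := by rw [harea]; simp [hx0]
    rw [this, mul_zero]
    positivity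
  -- `(x, y)` runs on the upper half of the comparison circle from `a` to `b`. On the way back, from
  -- `b` to `a + 1`, the lower half `(x, -y)` is used, so both arcs contribute `π r² / 2`.
  set y : ℝ → ℝ := fun u => r * √(1 - (x u / r) ^ 2) with hydef
  have hyc : Continuous y := by fun_prop
  have hxy : ∀ u, x u ^ 2 + y u ^ 2 = r ^ 2 := fun u => by
    have h1 : (x u / r) ^ 2 ≤ 1 := by
      rw [div_pow, div_le_one (by positivity)]; exact hxabs u
    simp only [hydef]
    rw [mul_pow, Real.sq_sqrt (by linarith)]
    field_simp
    ring
  have hn : ∀ u, (deriv γ u).im ^ 2 + (deriv γ u).re ^ 2 = ‖deriv γ u‖ ^ 2 := fun u => by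
    rw [Complex.sq_norm, Complex.normSq_apply]; ring
  have hI1 : ∫ u in a..b, y u * (deriv γ u).re = Real.pi * r ^ 2 / 2 :=
    integral_circle_arc hrpos hx hcre hxa hxb
  have hI2 : ∫ u in b..(a + 1), y u * (deriv γ u).re = -(Real.pi * r ^ 2 / 2) := by
    rw [intervalIntegral.integral_symm]
    exact congrArg Neg.neg (integral_circle_arc hrpos hx hcre hxa' hxb)
  have hc1 : Continuous fun u => x u * (deriv γ u).im := by fun_prop
  have hc2 : Continuous fun u => y u * (deriv γ u).re := by fun_prop
  have hc3 : Continuous fun u => ‖deriv γ u‖ := hc.norm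
  have hJ1 : (∫ u in a..b, x u * (deriv γ u).im) + Real.pi * r ^ 2 / 2 ≤
      r * ∫ u in a..b, ‖deriv γ u‖ := by
    rw [← hI1, ← intervalIntegral.integral_add (hc1.intervalIntegrable _ _)
      (hc2.intervalIntegrable _ _), ← intervalIntegral.integral_const_mul]
    exact intervalIntegral.integral_mono_on hab ((hc1.add hc2).intervalIntegrable _ _)
      ((hc3.const_mul r).intervalIntegrable _ _) fun u _ =>
        mul_add_mul_le_of_sq_add_sq hr0 (norm_nonneg _) (hxy u) (hn u)
  have hJ2 : (∫ u in b..(a + 1), x u * (deriv γ u).im) + Real.pi * r ^ 2 / 2 ≤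
      r * ∫ u in b..(a + 1), ‖deriv γ u‖ := by
    rw [← neg_neg (Real.pi * r ^ 2 / 2), ← hI2, ← sub_eq_add_neg, ← intervalIntegral.integral_sub
      (hc1.intervalIntegrable _ _) (hc2.intervalIntegrable _ _),
      ← intervalIntegral.integral_const_mul]
    refine intervalIntegral.integral_mono_on hba ((hc1.sub hc2).intervalIntegrable _ _)
      ((hc3.const_mul r).intervalIntegrable _ _) fun u _ => ?_
    have := mul_add_mul_le_of_sq_add_sq (a := x u) (b := -y u) hr0 (norm_nonneg _)
      (by rw [neg_sq]; exact hxy u) (hn u)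
    linarith
  have hA : area γ = (∫ u in a..b, x u * (deriv γ u).im) +
      ∫ u in b..(a + 1), x u * (deriv γ u).im := by
    rw [harea, intervalIntegral.integral_add_adjacent_intervals (hc1.intervalIntegrable _ _)
      (hc1.intervalIntegrable _ _)]
  have hL : length γ = (∫ u in a..b, ‖deriv γ u‖) + ∫ u in b..(a + 1), ‖deriv γ u‖ := by
    rw [hlen, intervalIntegral.integral_add_adjacent_intervals (hc3.intervalIntegrable _ _)
      (hc3.intervalIntegrable _ _)]
  have hmain : area γ + Real.pi * r ^ 2 ≤ r * length γ := by
    rw [hA, hL]; linarith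
  rcases le_or_gt (area γ) 0 with hneg | hpos
  · have : 4 * Real.pi * area γ ≤ 0 := mul_nonpos_of_nonneg_of_nonpos (by positivity) hneg
    exact this.trans (sq_nonneg _)
  -- The arithmetic-geometric inequality `4 A (π r²) ≤ (A + π r²)²` eliminates `r`. The case `A ≤ 0`
  -- was split off so that squaring is legitimate.
  have h1 : (area γ + Real.pi * r ^ 2) ^ 2 ≤ (r * length γ) ^ 2 :=
    pow_le_pow_left₀ (by positivity) hmain 2
  have h2 : r ^ 2 * (4 * Real.pi * area γ) ≤ r ^ 2 * length γ ^ 2 := by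
    nlinarith [sq_nonneg (area γ - Real.pi * r ^ 2)]
  exact le_of_mul_le_mul_left h2 (by positivity)

end Isoperimetric

/-! ### Integrals depending on time, and the first variations of area and length. -/

section Parametric

variable {E : Type*} [NormedAddCommGroup E] {S : Set ℝ} {F : ℝ → ℝ → E} {t : ℝ}

theorem continuous_slice (hF : ContinuousOn (fun p : ℝ × ℝ => F p.1 p.2) {p | p.1 ∈ S})
    (ht : t ∈ S) : Continuous (F t) :=
  continuousOn_univ.1 <| hF.comp (f := fun u : ℝ => (t, u)) (by fun_prop) fun _ _ => ht

theorem continuousOn_slice (hF : ContinuousOn (fun p : ℝ × ℝ => F p.1 p.2) {p | p.1 ∈ S})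
    (u : ℝ) : ContinuousOn (fun s => F s u) S :=
  hF.comp (f := fun s : ℝ => (s, u)) (by fun_prop) fun _ hs => hs

theorem continuousOn_integral_of_continuousOn [NormedSpace ℝ E]
    (hF : ContinuousOn (fun p : ℝ × ℝ => F p.1 p.2) {p | p.1 ∈ S}) :
    ContinuousOn (fun s => ∫ u in (0 : ℝ)..1, F s u) S := by
  rw [continuousOn_iff_continuous_domRestrict]
  refine intervalIntegral.continuous_parametric_intervalIntegral_of_continuous'
    (f := fun (s : S) u => F s u) ?_ 0 1
  exact continuousOn_univ.1 <| hF.comp (f := fun p : S × ℝ => ((p.1 : ℝ), p.2)) (by fun_prop)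
    fun p _ => p.1.2

theorem exists_eventually_norm_le (hF : ContinuousOn (fun p : ℝ × ℝ => F p.1 p.2) {p | p.1 ∈ S})
    (hS : S ∈ 𝓝 t) : ∃ C, ∀ᶠ s in 𝓝 t, ∀ u ∈ Set.Icc (0 : ℝ) 1, ‖F s u‖ ≤ C := by
  obtain ⟨K, hK, hKS, hKc⟩ := LocallyCompactSpace.local_compact_nhds t S hS
  obtain ⟨C, hC⟩ := (hKc.prod isCompact_Icc).exists_bound_of_continuousOn
    (hF.mono (show K ×ˢ Set.Icc (0 : ℝ) 1 ⊆ {p : ℝ × ℝ | p.1 ∈ S} from fun p hp => hKS hp.1))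
  exact ⟨C, mem_of_superset hK fun s hs u hu => hC (s, u) ⟨hs, hu⟩⟩

end Parametric

/-- Dominated convergence: near `t` the weight `P` is bounded by compactness and the difference
quotient of `X` by the Lipschitz hypothesis. The weight may depend on `s`, because the increments of
area and length involve the curve at both times. -/
theorem tendsto_integral_inner_slope {S : Set ℝ} {P X : ℝ → ℝ → ℂ} {W : ℝ → ℂ} {t : ℝ}
    (hS : S ∈ 𝓝 t) (hP : ContinuousOn (fun p : ℝ × ℝ => P p.1 p.2) {p | p.1 ∈ S})
    (hX : ContinuousOn (fun p : ℝ × ℝ => X p.1 p.2) {p | p.1 ∈ S})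
    (hW : ∀ u, HasDerivAt (fun s => X s u) (W u) t)
    (hL : ∃ C, ∀ᶠ s in 𝓝 t, ∀ u ∈ Set.Icc (0 : ℝ) 1, ‖X s u - X t u‖ ≤ C * ‖s - t‖) :
    Tendsto (fun s => (s - t)⁻¹ * ∫ u in (0 : ℝ)..1, inner ℝ (P s u) (X s u - X t u)) (𝓝[≠] t)
      (𝓝 (∫ u in (0 : ℝ)..1, inner ℝ (P t u) (W u))) := by
  obtain ⟨B, hB⟩ := exists_eventually_norm_le hP hS
  obtain ⟨C, hC⟩ := hL
  simp only [← intervalIntegral.integral_const_mul]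
  refine intervalIntegral.tendsto_integral_filter_of_dominated_convergence (fun _ => B * C)
    ?_ ?_ intervalIntegrable_const ?_
  · filter_upwards [nhdsWithin_le_nhds hS] with s hs
    have h1 := continuous_slice hP hs
    have h2 := continuous_slice hX hs
    have h3 := continuous_slice hX (mem_of_mem_nhds hS)
    exact (continuous_const.mul (h1.inner (h2.sub h3))).aestronglyMeasurable
  · filter_upwards [nhdsWithin_le_nhds hB, nhdsWithin_le_nhds hC, self_mem_nhdsWithin]
      with s hBs hCs hst
    refine Eventually.of_forall fun u hu => ?_
    rw [Set.uIoc_of_le zero_le_one] at hu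
    have hu' : u ∈ Set.Icc (0 : ℝ) 1 := ⟨hu.1.le, hu.2⟩
    have hpos : 0 < ‖s - t‖ := norm_pos_iff.2 (sub_ne_zero.2 hst)
    have hB0 : 0 ≤ B := (norm_nonneg _).trans (hBs u hu')
    rw [norm_mul, norm_inv, inv_mul_le_iff₀ hpos]
    calc ‖inner ℝ (P s u) (X s u - X t u)‖ ≤ ‖P s u‖ * ‖X s u - X t u‖ := norm_inner_le_norm _ _
      _ ≤ B * (C * ‖s - t‖) := mul_le_mul (hBs u hu') (hCs u hu') (norm_nonneg _) hB0
      _ = ‖s - t‖ * (B * C) := by ring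
  · refine Eventually.of_forall fun u _ => ?_
    have h1 : Tendsto (fun s => P s u) (𝓝[≠] t) (𝓝 (P t u)) :=
      ((continuousOn_slice hP u).continuousAt hS).tendsto.mono_left nhdsWithin_le_nhds
    have h2 := h1.inner (𝕜 := ℝ) (hasDerivAt_iff_tendsto_slope.1 (hW u))
    refine h2.congr fun s => ?_
    rw [slope_def_module, inner_smul_right]

/-- Mean value inequality on a ball around `t`, with a velocity bound uniform in `u`. -/
theorem exists_eventually_norm_sub_le {X W : ℝ → ℝ → ℂ} {t : ℝ}
    (hW : ∀ᶠ s in 𝓝 t, ∀ u, HasDerivAt (fun s' => X s' u) (W s u) s)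
    (hb : ∃ C, ∀ᶠ s in 𝓝 t, ∀ u ∈ Set.Icc (0 : ℝ) 1, ‖W s u‖ ≤ C) :
    ∃ C, ∀ᶠ s in 𝓝 t, ∀ u ∈ Set.Icc (0 : ℝ) 1, ‖X s u - X t u‖ ≤ C * ‖s - t‖ := by
  obtain ⟨C, hC⟩ := hb
  obtain ⟨ε, hε, hball⟩ := Metric.eventually_nhds_iff_ball.1 (hW.and hC)
  refine ⟨C, Metric.eventually_nhds_iff_ball.2 ⟨ε, hε, fun s hs u hu => ?_⟩⟩
  exact (convex_ball t ε).norm_image_sub_le_of_norm_hasDerivWithin_le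
    (f := fun s' => X s' u) (f' := fun s' => W s' u)
    (fun r hr => ((hball r hr).1 u).hasDerivWithinAt) (fun r hr => (hball r hr).2 u hu)
    (Metric.mem_ball_self hε) hs

/-- First variation of the area of a family of closed curves. -/
theorem hasDerivAt_area {S : Set ℝ} {X : ℝ → ℝ → ℂ} {W : ℝ → ℂ} {t : ℝ} (hS : S ∈ 𝓝 t)
    (h2 : ∀ s ∈ S, ContDiff ℝ 2 (X s)) (hr : ∀ s ∈ S, ∀ u, deriv (X s) u ≠ 0)
    (hp : ∀ s ∈ S, Function.Periodic (X s) 1)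
    (hX : ContinuousOn (fun p : ℝ × ℝ => X p.1 p.2) {p | p.1 ∈ S})
    (hX' : ContinuousOn (fun p : ℝ × ℝ => deriv (X p.1) p.2) {p | p.1 ∈ S})
    (hW : ∀ u, HasDerivAt (fun s => X s u) (W u) t)
    (hL : ∃ C, ∀ᶠ s in 𝓝 t, ∀ u ∈ Set.Icc (0 : ℝ) 1, ‖X s u - X t u‖ ≤ C * ‖s - t‖) :
    HasDerivAt (fun s => area (X s))
      (∫ u in (0 : ℝ)..1, inner ℝ (-Complex.I * deriv (X t) u) (W u)) t := by
  have htS := mem_of_mem_nhds hS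
  have hXt' := continuous_slice (F := fun s u => deriv (X s) u) hX' htS
  -- Area is a quadratic form, so its increment is the polar form of the sum `X s + X t` with the
  -- difference `X s - X t`; this weight is the derivative of the sum.
  have h := tendsto_integral_inner_slope
    (P := fun s u => -(Complex.I / 2) * (deriv (X s) u + deriv (X t) u)) hS
    (continuousOn_const.mul (hX'.add (hXt'.comp continuous_snd).continuousOn)) hX hW hL
  rw [hasDerivAt_iff_tendsto_slope]
  have heq : ∀ u, -(Complex.I / 2) * (deriv (X t) u + deriv (X t) u) =
      -Complex.I * deriv (X t) u := fun u => by ring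
  simp only [heq] at h
  refine h.congr' ?_
  filter_upwards [nhdsWithin_le_nhds hS] with s hs
  rw [slope_def_module, smul_eq_mul]
  congr 1
  have hXs' := continuous_slice (F := fun s u => deriv (X s) u) hX' hs
  have hcs := (h2 s hs).continuous
  have hct := (h2 t htS).continuous
  have hparts := integral_inner_deriv_of_periodic (f := X t)
    (g := fun u => -(Complex.I / 2) * X s u) (hasDerivAt_of_contDiff_two (h2 t htS))
    (fun u => (hasDerivAt_of_contDiff_two (h2 s hs) u).const_mul _) hXt'
    (continuous_const.mul hXs') (by simpa using hp t htS 0)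
    (by rw [show X s 1 = X s 0 by simpa using hp s hs 0])
  rw [area_eq (hr s hs), area_eq (hr t htS)]
  have hi : ∀ {f g : ℝ → ℂ}, Continuous f → Continuous g →
      IntervalIntegrable (fun u => inner ℝ (f u) (-(Complex.I / 2) * g u)) volume 0 1 :=
    fun hf hg => (hf.inner (continuous_const.mul hg)).intervalIntegrable _ _
  have hJre : (-(Complex.I / 2)).re = 0 := by simp
  have hJim : (-(Complex.I / 2)).im = -(1 / 2) := by simp
  -- The integrand is the difference of the two area densities up to mixed terms, whose integral
  -- vanishes by `hparts`.
  calc ∫ u in (0 : ℝ)..1,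
        inner ℝ (-(Complex.I / 2) * (deriv (X s) u + deriv (X t) u)) (X s u - X t u)
      = ∫ u in (0 : ℝ)..1, (inner ℝ (X s u) (-(Complex.I / 2) * deriv (X s) u) -
          inner ℝ (X t u) (-(Complex.I / 2) * deriv (X t) u)) -
          (inner ℝ (X t u) (-(Complex.I / 2) * deriv (X s) u) +
            inner ℝ (deriv (X t) u) (-(Complex.I / 2) * X s u)) := by
        congr 1
        ext u
        simp only [inner_eq_re_im, Complex.mul_re, Complex.mul_im, hJre, hJim, Complex.add_re,
          Complex.add_im, Complex.sub_re, Complex.sub_im]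
        ring
    _ = _ := by
        rw [intervalIntegral.integral_sub ((hi hcs hXs').sub (hi hct hXt'))
          ((hi hct hXs').add (hi hXt' hcs)), intervalIntegral.integral_sub (hi hcs hXs')
          (hi hct hXt'), intervalIntegral.integral_add (hi hct hXs') (hi hXt' hcs), hparts]
        ring

/-- Convexity of the norm: `⟨τ, η'⟩ ≤ ‖η'‖` with `τ` the unit tangent of `γ`, with equality for `η =
γ`. Integration by parts then moves the derivative from `η - γ` onto `τ`. Exchanging the two curves
gives the matching upper bound. -/
theorem length_sub_length_ge {γ η : ℝ → ℂ} (hγ : ContDiff ℝ 2 γ) (hη : ContDiff ℝ 2 η)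
    (hr : ∀ u, deriv γ u ≠ 0) (hγp : Function.Periodic γ 1) (hηp : Function.Periodic η 1) :
    ∫ u in (0 : ℝ)..1, inner ℝ (-turningRate γ u • normal γ u) (η u - γ u) ≤
      length η - length γ := by
  have hγ' := continuous_deriv_of_contDiff_two hγ
  have hη' := continuous_deriv_of_contDiff_two hη
  have hτ := continuous_tangent hγ hr
  have hparts := integral_inner_deriv_of_periodic (f := tangent γ) (g := fun u => η u - γ u)
    (hasDerivAt_tangent hγ hr)
    (fun u => (hasDerivAt_of_contDiff_two hη u).sub (hasDerivAt_of_contDiff_two hγ u))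
    ((continuous_turningRate hγ hr).smul (continuous_normal hγ hr)) (hη'.sub hγ')
    (by simpa using periodic_tangent hγp 0)
    (by rw [show γ 1 = γ 0 by simpa using hγp 0, show η 1 = η 0 by simpa using hηp 0])
  have h1 : ∫ u in (0 : ℝ)..1, inner ℝ (-turningRate γ u • normal γ u) (η u - γ u) =
      ∫ u in (0 : ℝ)..1, inner ℝ (tangent γ u) (deriv η u - deriv γ u) := by
    rw [hparts, ← intervalIntegral.integral_neg]
    simp only [neg_smul, inner_neg_left]
  rw [h1, length, length, ← intervalIntegral.integral_sub (hη'.norm.intervalIntegrable _ _)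
    (hγ'.norm.intervalIntegrable _ _)]
  refine intervalIntegral.integral_mono_on zero_le_one
    ((hτ.inner (hη'.sub hγ')).intervalIntegrable _ _)
    ((hη'.norm.sub hγ'.norm).intervalIntegrable _ _) fun u _ => ?_
  rw [inner_sub_right]
  have h2 : inner ℝ (tangent γ u) (deriv γ u) = ‖deriv γ u‖ := by
    nth_rw 1 [← norm_smul_tangent hr u]
    rw [inner_smul_right, real_inner_self_eq_norm_sq, norm_tangent hr]
    ring
  have h3 : inner ℝ (tangent γ u) (deriv η u) ≤ ‖deriv η u‖ := by
    refine (real_inner_le_norm _ _).trans ?_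
    rw [norm_tangent hr, one_mul]
  rw [h2]
  linarith

section JointContinuity

variable {S : Set ℝ} {X : ℝ → ℝ → ℂ}

theorem continuousOn_normal_joint (hr : ∀ s ∈ S, ∀ u, deriv (X s) u ≠ 0)
    (hX' : ContinuousOn (fun p : ℝ × ℝ => deriv (X p.1) p.2) {p | p.1 ∈ S}) :
    ContinuousOn (fun p : ℝ × ℝ => normal (X p.1) p.2) {p | p.1 ∈ S} :=
  continuousOn_const.mul <| (hX'.norm.inv₀ fun p hp => norm_ne_zero_iff.2 (hr p.1 hp p.2)).smul hX'

theorem continuousOn_turningRate_joint (hr : ∀ s ∈ S, ∀ u, deriv (X s) u ≠ 0)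
    (hX' : ContinuousOn (fun p : ℝ × ℝ => deriv (X p.1) p.2) {p | p.1 ∈ S})
    (hX'' : ContinuousOn (fun p : ℝ × ℝ => deriv (deriv (X p.1)) p.2) {p | p.1 ∈ S}) :
    ContinuousOn (fun p : ℝ × ℝ => turningRate (X p.1) p.2) {p | p.1 ∈ S} :=
  (hX''.inner (𝕜 := ℝ) (continuousOn_const.mul hX')).div (hX'.norm.pow 2)
    fun p hp => pow_ne_zero _ (norm_ne_zero_iff.2 (hr p.1 hp p.2))

theorem continuousOn_curvature_joint (hr : ∀ s ∈ S, ∀ u, deriv (X s) u ≠ 0)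
    (hX' : ContinuousOn (fun p : ℝ × ℝ => deriv (X p.1) p.2) {p | p.1 ∈ S})
    (hX'' : ContinuousOn (fun p : ℝ × ℝ => deriv (deriv (X p.1)) p.2) {p | p.1 ∈ S})
    (h2 : ∀ s ∈ S, ContDiff ℝ 2 (X s)) :
    ContinuousOn (fun p : ℝ × ℝ => curvature (X p.1) p.2) {p | p.1 ∈ S} :=
  ((continuousOn_turningRate_joint hr hX' hX'').div hX'.norm
    fun p hp => norm_ne_zero_iff.2 (hr p.1 hp p.2)).congr
      fun p hp => curvature_eq (h2 p.1 hp) (hr p.1 hp) p.2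

end JointContinuity

/-- First variation of the length of a family of closed curves. The curves are only twice
differentiable, so the velocity need not be differentiable along the curve; the convexity of the
norm replaces the derivative under the integral. -/
theorem hasDerivAt_length {S : Set ℝ} {X : ℝ → ℝ → ℂ} {W : ℝ → ℂ} {t : ℝ} (hS : S ∈ 𝓝 t)
    (h2 : ∀ s ∈ S, ContDiff ℝ 2 (X s)) (hr : ∀ s ∈ S, ∀ u, deriv (X s) u ≠ 0)
    (hp : ∀ s ∈ S, Function.Periodic (X s) 1)
    (hX : ContinuousOn (fun p : ℝ × ℝ => X p.1 p.2) {p | p.1 ∈ S})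
    (hX' : ContinuousOn (fun p : ℝ × ℝ => deriv (X p.1) p.2) {p | p.1 ∈ S})
    (hX'' : ContinuousOn (fun p : ℝ × ℝ => deriv (deriv (X p.1)) p.2) {p | p.1 ∈ S})
    (hW : ∀ u, HasDerivAt (fun s => X s u) (W u) t)
    (hL : ∃ C, ∀ᶠ s in 𝓝 t, ∀ u ∈ Set.Icc (0 : ℝ) 1, ‖X s u - X t u‖ ≤ C * ‖s - t‖) :
    HasDerivAt (fun s => length (X s))
      (∫ u in (0 : ℝ)..1, inner ℝ (-turningRate (X t) u • normal (X t) u) (W u)) t := by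
  have htS := mem_of_mem_nhds hS
  have hN := (continuousOn_turningRate_joint hr hX' hX'').neg.smul (continuousOn_normal_joint hr hX')
  have hN' := continuous_slice (F := fun s u => -turningRate (X s) u • normal (X s) u) hN htS
  have hlow := tendsto_integral_inner_slope
    (P := fun _ u => -turningRate (X t) u • normal (X t) u) hS
    (hN'.comp continuous_snd).continuousOn hX hW hL
  have hupp := tendsto_integral_inner_slope
    (P := fun s u => -turningRate (X s) u • normal (X s) u) hS hN hX hW hL
  rw [hasDerivAt_iff_tendsto_slope]
  -- Division by `s - t` reverses the two bounds when `s < t`; squeezing between their minimum and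
  -- maximum covers both signs.
  have hmin := hlow.min hupp
  have hmax := hlow.max hupp
  rw [min_self] at hmin
  rw [max_self] at hmax
  have key : ∀ᶠ s in 𝓝[≠] t,
      (∫ u in (0 : ℝ)..1, inner ℝ (-turningRate (X t) u • normal (X t) u) (X s u - X t u)) ≤
        length (X s) - length (X t) ∧ length (X s) - length (X t) ≤
      ∫ u in (0 : ℝ)..1, inner ℝ (-turningRate (X s) u • normal (X s) u) (X s u - X t u) := by
    filter_upwards [nhdsWithin_le_nhds hS] with s hs
    refine ⟨length_sub_length_ge (h2 t htS) (h2 s hs) (hr t htS) (hp t htS) (hp s hs), ?_⟩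
    have h := length_sub_length_ge (h2 s hs) (h2 t htS) (hr s hs) (hp s hs) (hp t htS)
    have hneg : ∀ u, inner ℝ (-turningRate (X s) u • normal (X s) u) (X t u - X s u) =
        -inner ℝ (-turningRate (X s) u • normal (X s) u) (X s u - X t u) := fun u => by
      rw [← inner_neg_right, neg_sub]
    simp only [hneg, intervalIntegral.integral_neg] at h
    linarith
  refine tendsto_of_tendsto_of_tendsto_of_le_of_le' hmin hmax ?_ ?_
  · filter_upwards [key] with s hs
    rw [slope_def_module, smul_eq_mul]
    rcases le_total 0 (s - t)⁻¹ with h | h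
    · exact (min_le_left _ _).trans (mul_le_mul_of_nonneg_left hs.1 h)
    · exact (min_le_right _ _).trans (mul_le_mul_of_nonpos_left hs.2 h)
  · filter_upwards [key] with s hs
    rw [slope_def_module, smul_eq_mul]
    rcases le_total 0 (s - t)⁻¹ with h | h
    · exact (mul_le_mul_of_nonneg_left hs.2 h).trans (le_max_right _ _)
    · exact (mul_le_mul_of_nonpos_left hs.1 h).trans (le_max_left _ _)

theorem integral_curvatureDev {γ : ℝ → ℂ} (hγ : ContDiff ℝ 2 γ) (hr : ∀ u, deriv γ u ≠ 0) :
    ∫ u in (0 : ℝ)..1, curvatureDev γ u * ‖deriv γ u‖ = 0 := by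
  have h1 := (continuous_deriv_of_contDiff_two hγ).norm
  have h2 := continuous_curvature hγ hr
  simp only [curvatureDev, sub_mul]
  rw [intervalIntegral.integral_sub (Continuous.intervalIntegrable (by fun_prop) _ _)
    (Continuous.intervalIntegrable (by fun_prop) _ _), intervalIntegral.integral_const_mul]
  change totalCurvature γ - 1 / length γ * totalCurvature γ * length γ = 0
  have := (length_pos hγ hr).ne'
  field_simp
  ring

theorem arcIntegral_sq_nonneg (γ : ℝ → ℂ) (h : ℝ → ℝ) : 0 ≤ arcIntegral γ fun u => h u ^ 2 :=
  intervalIntegral.integral_nonneg zero_le_one fun _ _ => by positivity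

theorem continuous_curvatureDev {γ : ℝ → ℂ} (hγ : ContDiff ℝ 2 γ) (hr : ∀ u, deriv γ u ≠ 0) :
    Continuous (curvatureDev γ) :=
  (continuous_curvature hγ hr).sub continuous_const

/-- The times `0 ≤ t < T`. -/
def timeInterval (T : EReal) : Set ℝ := {t | 0 ≤ t ∧ (t : EReal) < T}

theorem mem_nhds_timeInterval {T : EReal} {t : ℝ} (h0 : 0 < t) (hT : (t : EReal) < T) :
    timeInterval T ∈ 𝓝 t := by
  have h1 : ∀ᶠ s : ℝ in 𝓝 t, (s : EReal) < T :=
    continuous_coe_real_ereal.continuousAt.eventually_lt_const hT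
  filter_upwards [lt_mem_nhds h0, h1] with s hs hs'
  exact ⟨hs.le, hs'⟩

theorem mem_timeInterval_of_le {T : EReal} {s t : ℝ} (ht : t ∈ timeInterval T) (h0 : 0 ≤ s)
    (hst : s ≤ t) : s ∈ timeInterval T :=
  ⟨h0, (EReal.coe_le_coe_iff.2 hst).trans_lt ht.2⟩

/-! ### Evolution of area, length, rotation number and deficit along a general flow. -/

namespace IsClassicalSolution

variable {g : (ℝ → ℂ) → ℝ} {T : EReal} {X : ℝ → ℝ → ℂ}

theorem contDiff_two (h : IsClassicalSolution g T X) : ∀ s ∈ timeInterval T, ContDiff ℝ 2 (X s) :=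
  fun s hs => h.contDiff s hs.1 hs.2

theorem deriv_ne_zero (h : IsClassicalSolution g T X) :
    ∀ s ∈ timeInterval T, ∀ u, deriv (X s) u ≠ 0 :=
  fun s hs => h.regular s hs.1 hs.2

theorem periodic_one (h : IsClassicalSolution g T X) :
    ∀ s ∈ timeInterval T, Function.Periodic (X s) 1 :=
  fun s hs => h.periodic s hs.1 hs.2

theorem length_pos (h : IsClassicalSolution g T X) {s : ℝ} (hs : s ∈ timeInterval T) :
    0 < length (X s) :=
  PlaneCurve.length_pos (h.contDiff_two s hs) (h.deriv_ne_zero s hs)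

theorem continuousOn_length (h : IsClassicalSolution g T X) :
    ContinuousOn (fun s => length (X s)) (timeInterval T) :=
  continuousOn_integral_of_continuousOn (F := fun s u => ‖deriv (X s) u‖) h.continuousOn_deriv.norm

theorem continuousOn_area (h : IsClassicalSolution g T X) :
    ContinuousOn (fun s => area (X s)) (timeInterval T) :=
  (continuousOn_integral_of_continuousOn
    (F := fun s u => inner ℝ (X s u) (-(Complex.I / 2) * deriv (X s) u))
    (h.continuousOn.inner (continuousOn_const.mul h.continuousOn_deriv))).congr
      fun s hs => area_eq (h.deriv_ne_zero s hs)

theorem continuousOn_totalCurvature (h : IsClassicalSolution g T X) :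
    ContinuousOn (fun s => totalCurvature (X s)) (timeInterval T) :=
  (continuousOn_integral_of_continuousOn (F := fun s u => turningRate (X s) u)
    (continuousOn_turningRate_joint h.deriv_ne_zero h.continuousOn_deriv
      h.continuousOn_deriv_two)).congr
      fun s hs => totalCurvature_eq (h.contDiff_two s hs) (h.deriv_ne_zero s hs)

theorem continuousOn_curvatureDev (h : IsClassicalSolution g T X) :
    ContinuousOn (fun p : ℝ × ℝ => curvatureDev (X p.1) p.2) {p | p.1 ∈ timeInterval T} := by
  have hL : ContinuousOn (fun s => 1 / length (X s)) (timeInterval T) :=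
    continuousOn_const.div h.continuousOn_length fun s hs => (h.length_pos hs).ne'
  exact (continuousOn_curvature_joint h.deriv_ne_zero h.continuousOn_deriv
    h.continuousOn_deriv_two h.contDiff_two).sub
      ((hL.mul h.continuousOn_totalCurvature).comp continuousOn_fst fun p hp => hp)

theorem continuousOn_arcIntegral_curvatureDev_sq (h : IsClassicalSolution g T X) :
    ContinuousOn (fun s => arcIntegral (X s) fun u => curvatureDev (X s) u ^ 2)
      (timeInterval T) :=
  continuousOn_integral_of_continuousOn
    (F := fun s u => curvatureDev (X s) u ^ 2 * ‖deriv (X s) u‖)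
    ((h.continuousOn_curvatureDev.pow 2).mul h.continuousOn_deriv.norm)

/-- The normal speed is bounded near `t` because `κ̃` is jointly continuous and `g / L` is
continuous at `t`. Continuity of the non-local term is verified for each flow separately. -/
theorem exists_norm_sub_le (h : IsClassicalSolution g T X) {t : ℝ} (h0 : 0 < t)
    (hT : (t : EReal) < T) (hg : ContinuousAt (fun s => g (X s)) t) :
    ∃ C, ∀ᶠ s in 𝓝 t, ∀ u ∈ Set.Icc (0 : ℝ) 1, ‖X s u - X t u‖ ≤ C * ‖s - t‖ := by
  have hS := mem_nhds_timeInterval h0 hT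
  have htS := mem_of_mem_nhds hS
  refine exists_eventually_norm_sub_le (W := fun s u =>
    (curvatureDev (X s) u - g (X s) / length (X s)) • normal (X s) u) ?_ ?_
  · filter_upwards [lt_mem_nhds h0, hS] with s hs hs' u
    exact h.equation s hs hs'.2 u
  · obtain ⟨C, hC⟩ := exists_eventually_norm_le (F := fun s u => curvatureDev (X s) u)
      h.continuousOn_curvatureDev hS
    have hq : ContinuousAt (fun s => g (X s) / length (X s)) t :=
      hg.div (h.continuousOn_length.continuousAt hS) (h.length_pos htS).ne'
    have hq' := hq.norm.eventually_lt_const (lt_add_one _)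
    refine ⟨C + (‖g (X t) / length (X t)‖ + 1), ?_⟩
    filter_upwards [hC, hq', hS] with s hs1 hs2 hs3 u hu
    rw [norm_smul, norm_normal (h.deriv_ne_zero s hs3), mul_one]
    exact (norm_sub_le _ _).trans (add_le_add (hs1 u hu) hs2.le)

theorem hasDerivAt_area (h : IsClassicalSolution g T X) {t : ℝ} (h0 : 0 < t)
    (hT : (t : EReal) < T) (hg : ContinuousAt (fun s => g (X s)) t) :
    HasDerivAt (fun s => area (X s)) (g (X t)) t := by
  have hS := mem_nhds_timeInterval h0 hT
  have htS := mem_of_mem_nhds hS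
  have h2 := h.contDiff_two t htS
  have hr := h.deriv_ne_zero t htS
  refine (PlaneCurve.hasDerivAt_area hS h.contDiff_two h.deriv_ne_zero h.periodic_one
    h.continuousOn h.continuousOn_deriv (h.equation t h0 hT)
    (h.exists_norm_sub_le h0 hT hg)).congr_deriv ?_
  have hc := (continuous_deriv_of_contDiff_two h2).norm
  have hdev := continuous_curvatureDev h2 hr
  have hpt : ∀ u, inner ℝ (-Complex.I * deriv (X t) u)
      ((curvatureDev (X t) u - g (X t) / length (X t)) • normal (X t) u) =
      g (X t) / length (X t) * ‖deriv (X t) u‖ - curvatureDev (X t) u * ‖deriv (X t) u‖ := by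
    intro u
    rw [neg_mul, ← norm_smul_normal hr u, inner_neg_left, inner_smul_left, inner_smul_right,
      real_inner_self_eq_norm_sq, norm_normal hr]
    simp only [conj_trivial]
    ring
  simp only [hpt]
  rw [intervalIntegral.integral_sub (Continuous.intervalIntegrable (by fun_prop) _ _)
    (Continuous.intervalIntegrable (by fun_prop) _ _),
    intervalIntegral.integral_const_mul, integral_curvatureDev h2 hr, sub_zero]
  exact div_mul_cancel₀ _ (h.length_pos htS).ne'

/-- In `-∫ κ (κ̃ - g / L) ds`, write `κ` as `κ̃` plus its mean; the mean pairs to zero with `κ̃`. -/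
theorem hasDerivAt_length (h : IsClassicalSolution g T X) {t : ℝ} (h0 : 0 < t)
    (hT : (t : EReal) < T) (hg : ContinuousAt (fun s => g (X s)) t) :
    HasDerivAt (fun s => length (X s)) (g (X t) / length (X t) * totalCurvature (X t) -
      arcIntegral (X t) fun u => curvatureDev (X t) u ^ 2) t := by
  have hS := mem_nhds_timeInterval h0 hT
  have htS := mem_of_mem_nhds hS
  have h2 := h.contDiff_two t htS
  have hr := h.deriv_ne_zero t htS
  refine (PlaneCurve.hasDerivAt_length hS h.contDiff_two h.deriv_ne_zero h.periodic_one
    h.continuousOn h.continuousOn_deriv h.continuousOn_deriv_two (h.equation t h0 hT)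
    (h.exists_norm_sub_le h0 hT hg)).congr_deriv ?_
  have hc := (continuous_deriv_of_contDiff_two h2).norm
  have hdev := continuous_curvatureDev h2 hr
  have hk := continuous_curvature h2 hr
  have hpt : ∀ u, inner ℝ (-turningRate (X t) u • normal (X t) u)
      ((curvatureDev (X t) u - g (X t) / length (X t)) • normal (X t) u) =
      g (X t) / length (X t) * (curvature (X t) u * ‖deriv (X t) u‖) -
      (curvatureDev (X t) u ^ 2 * ‖deriv (X t) u‖ +
        1 / length (X t) * totalCurvature (X t) * (curvatureDev (X t) u * ‖deriv (X t) u‖)) := by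
    intro u
    rw [inner_smul_left, inner_smul_right, real_inner_self_eq_norm_sq, norm_normal hr,
      ← curvature_mul_norm h2 hr]
    simp only [conj_trivial, curvatureDev]
    ring
  simp only [hpt]
  rw [intervalIntegral.integral_sub (Continuous.intervalIntegrable (by fun_prop) _ _)
    (Continuous.intervalIntegrable (by fun_prop) _ _),
    intervalIntegral.integral_add (Continuous.intervalIntegrable (by fun_prop) _ _)
    (Continuous.intervalIntegrable (by fun_prop) _ _),
    intervalIntegral.integral_const_mul, intervalIntegral.integral_const_mul,
    integral_curvatureDev h2 hr, mul_zero, add_zero]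
  rfl

theorem ordConnected_timeInterval (T : EReal) : (timeInterval T).OrdConnected :=
  ⟨fun _ hx _ hy _ hz => mem_timeInterval_of_le hy (hx.1.trans hz.1) hz.2⟩

/-- The rotation number is constant along the flow. -/
theorem totalCurvature_eq_of_zero (h : IsClassicalSolution g T X) {t : ℝ}
    (ht : t ∈ timeInterval T) : totalCurvature (X t) = totalCurvature (X 0) := by
  have hpi : 2 * Real.pi ≠ 0 := by positivity
  -- A continuous map from an interval into the discrete set of integers is constant.
  have hmaps : Set.MapsTo (fun s => totalCurvature (X s) / (2 * Real.pi)) (timeInterval T)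
      (Set.range ((↑) : ℤ → ℝ)) := fun s hs => by
    obtain ⟨m, hm⟩ := exists_totalCurvature_eq (h.contDiff_two s hs) (h.deriv_ne_zero s hs)
      (h.periodic_one s hs)
    exact ⟨m, by simp only [hm]; field_simp⟩
  have hconst := (ordConnected_timeInterval T).isPreconnected.constant_of_mapsTo
    Int.isClosedEmbedding_coe_real.isInducing.isDiscrete_range
    (h.continuousOn_totalCurvature.div_const _) hmaps ht
    (mem_timeInterval_of_le ht le_rfl ht.1)
  exact (div_left_inj' hpi).1 hconst

theorem totalCurvature_eq_two_pi_mul (h : IsClassicalSolution g T X) {n t : ℝ}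
    (hrot : rotationNumber (X 0) = n) (ht : t ∈ timeInterval T) :
    totalCurvature (X t) = 2 * Real.pi * n := by
  rw [h.totalCurvature_eq_of_zero ht, ← hrot, rotationNumber]
  have := Real.pi_ne_zero
  field_simp

theorem isoDeficit_eq (h : IsClassicalSolution g T X) {n t : ℝ}
    (hrot : rotationNumber (X 0) = n) (ht : t ∈ timeInterval T) :
    isoDeficit (X t) = 1 - 4 * n * Real.pi * area (X t) / length (X t) ^ 2 := by
  have : rotationNumber (X t) = n := by
    rw [← hrot, rotationNumber, rotationNumber, h.totalCurvature_eq_of_zero ht]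
  rw [isoDeficit, this]

/-- With the rotation number frozen, only `A / L²` varies; the quantity in `hsign` is `L⁴` times its
derivative, after inserting `L L' = g K - L E`. -/
theorem hasDerivAt_isoDeficit_nonpos (h : IsClassicalSolution g T X) {n t : ℝ}
    (hrot : rotationNumber (X 0) = n) (hn : 0 ≤ n) (h0 : 0 < t) (hT : (t : EReal) < T)
    (hg : ContinuousAt (fun s => g (X s)) t)
    (hsign : 0 ≤ g (X t) * (length (X t) ^ 2 - 2 * area (X t) * totalCurvature (X t)) +
      2 * area (X t) * length (X t) * arcIntegral (X t) fun u => curvatureDev (X t) u ^ 2) :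
    ∃ d ≤ 0, HasDerivAt (fun s => isoDeficit (X s)) d t := by
  have hS := mem_nhds_timeInterval h0 hT
  have htS := mem_of_mem_nhds hS
  have hL := h.length_pos htS
  have hd := (((h.hasDerivAt_area h0 hT hg).const_mul (4 * n * Real.pi)).div
    ((h.hasDerivAt_length h0 hT hg).pow 2) (pow_ne_zero 2 hL.ne')).const_sub 1
  have heq : (fun s => isoDeficit (X s)) =ᶠ[𝓝 t]
      fun s => 1 - 4 * n * Real.pi * area (X s) / length (X s) ^ 2 := by
    filter_upwards [hS] with s hs using h.isoDeficit_eq hrot hs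
  refine ⟨_, ?_, hd.congr_of_eventuallyEq heq⟩
  rw [neg_nonpos]
  refine div_nonneg ?_ (by positivity)
  have hpos : 0 ≤ 4 * n * Real.pi := by positivity
  refine (mul_nonneg hpos hsign).trans_eq ?_
  simp only [Pi.pow_apply]
  field_simp
  push_cast
  ring

theorem hasDerivAt_length_sq (h : IsClassicalSolution g T X) {t : ℝ} (h0 : 0 < t)
    (hT : (t : EReal) < T) (hg : ContinuousAt (fun s => g (X s)) t) :
    HasDerivAt (fun s => length (X s) ^ 2) (2 * (g (X t) * totalCurvature (X t) -
      length (X t) * arcIntegral (X t) fun u => curvatureDev (X t) u ^ 2)) t := by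
  have hL := h.length_pos (mem_of_mem_nhds (mem_nhds_timeInterval h0 hT))
  refine ((h.hasDerivAt_length h0 hT hg).pow 2).congr_deriv ?_
  field_simp
  push_cast
  ring

/-- The lower bound is the isoperimetric inequality. The upper bound is monotonicity, extended to
the initial time by continuity. For `n > 0` the deficit is a decreasing function of `A / L²`, which
gives the bounds on `L² / A`. -/
theorem isoDeficit_bounds (h : IsClassicalSolution g T X) {n : ℝ}
    (hrot : rotationNumber (X 0) = n) (hn : 0 < n) (hA : ∀ s ∈ timeInterval T, 0 < area (X s))
    (hI : ∀ s : ℝ, 0 < s → (s : EReal) < T →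
      ∃ d ≤ 0, HasDerivAt (fun s => isoDeficit (X s)) d s)
    {t : ℝ} (ht : t ∈ timeInterval T) :
    (1 - n ≤ isoDeficit (X t) ∧ isoDeficit (X t) ≤ isoDeficit (X 0)) ∧
      (4 * Real.pi ≤ length (X t) ^ 2 / area (X t) ∧
        length (X t) ^ 2 / area (X t) ≤ length (X 0) ^ 2 / area (X 0)) := by
  have h0S : (0 : ℝ) ∈ timeInterval T := mem_timeInterval_of_le ht le_rfl ht.1
  have hL := h.length_pos ht
  have hL0 := h.length_pos h0S
  have hAt := hA t ht
  have hA0 := hA 0 h0S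
  have hiso := four_pi_mul_area_le (h.contDiff_two t ht) (h.deriv_ne_zero t ht)
    (h.periodic_one t ht)
  have hcont : ContinuousOn (fun s => isoDeficit (X s)) (timeInterval T) :=
    (continuousOn_const.sub ((continuousOn_const.mul h.continuousOn_area).div
      (h.continuousOn_length.pow 2) fun s hs => pow_ne_zero 2 (h.length_pos hs).ne')).congr
        fun s hs => h.isoDeficit_eq hrot hs
  have hanti : AntitoneOn (fun s => isoDeficit (X s)) (Set.Icc 0 t) := by
    have hI' : ∀ s ∈ interior (Set.Icc 0 t),
        ∃ d ≤ 0, HasDerivAt (fun s => isoDeficit (X s)) d s := fun s hs => by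
      rw [interior_Icc] at hs
      exact hI s hs.1 (mem_timeInterval_of_le ht hs.1.le hs.2.le).2
    refine antitoneOn_of_deriv_nonpos (convex_Icc 0 t)
      (hcont.mono fun s hs => mem_timeInterval_of_le ht hs.1 hs.2) ?_ ?_
    · intro s hs
      obtain ⟨d, -, hd⟩ := hI' s hs
      exact hd.differentiableAt.differentiableWithinAt
    · intro s hs
      obtain ⟨d, hd0, hd⟩ := hI' s hs
      rwa [hd.deriv]
  have hle : isoDeficit (X t) ≤ isoDeficit (X 0) :=
    hanti (Set.left_mem_Icc.2 ht.1) (Set.right_mem_Icc.2 ht.1) ht.1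
  have hratio : area (X 0) / length (X 0) ^ 2 ≤ area (X t) / length (X t) ^ 2 := by
    have h1 := hle
    rw [h.isoDeficit_eq hrot ht, h.isoDeficit_eq hrot h0S, sub_le_sub_iff_left, mul_div_assoc,
      mul_div_assoc] at h1
    exact le_of_mul_le_mul_left h1 (by positivity)
  refine ⟨⟨?_, hle⟩, ?_, ?_⟩
  · rw [h.isoDeficit_eq hrot ht, sub_le_sub_iff_left, div_le_iff₀ (by positivity)]
    calc 4 * n * Real.pi * area (X t) = n * (4 * Real.pi * area (X t)) := by ring
      _ ≤ n * length (X t) ^ 2 := mul_le_mul_of_nonneg_left hiso hn.le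
  · rwa [le_div_iff₀ hAt]
  · rw [← inv_div (area (X t)), ← inv_div (area (X 0))]
    exact inv_anti₀ (by positivity) hratio

/-! ### The three non-local terms, and the sign of the area. -/

theorem continuousAt_gAP (t : ℝ) : ContinuousAt (fun s => gAP (X s)) t :=
  continuousAt_const

theorem continuousAt_gLP (h : IsClassicalSolution g T X) {t : ℝ} (h0 : 0 < t)
    (hT : (t : EReal) < T) (hK : totalCurvature (X t) ≠ 0) :
    ContinuousAt (fun s => gLP (X s)) t := by
  have hS := mem_nhds_timeInterval h0 hT
  exact ((h.continuousOn_length.continuousAt hS).mul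
    ((h.continuousOn_totalCurvature.continuousAt hS).inv₀ hK)).mul
      (h.continuousOn_arcIntegral_curvatureDev_sq.continuousAt hS)

theorem continuousAt_gJP (h : IsClassicalSolution g T X) {t : ℝ} (h0 : 0 < t)
    (hT : (t : EReal) < T) (hA : area (X t) ≠ 0) :
    ContinuousAt (fun s => gJP (X s)) t := by
  have hS := mem_nhds_timeInterval h0 hT
  exact (((h.continuousOn_length.continuousAt hS).pow 2).div
    (continuousAt_const.mul (h.continuousOn_area.continuousAt hS))
    (mul_ne_zero two_ne_zero hA)).sub (h.continuousOn_totalCurvature.continuousAt hS)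

/-- The term `g` is controlled only in the open interval, since for (JP) it may be singular at the
right end; continuity of the area closes the interval. -/
theorem monotoneOn_area (h : IsClassicalSolution g T X) {a b : ℝ} (ha : 0 ≤ a)
    (hb : b ∈ timeInterval T)
    (hg : ∀ s ∈ Set.Ioo a b, ContinuousAt (fun s => g (X s)) s ∧ 0 ≤ g (X s)) :
    MonotoneOn (fun s => area (X s)) (Set.Icc a b) := by
  have hd : ∀ s ∈ interior (Set.Icc a b), HasDerivAt (fun s => area (X s)) (g (X s)) s ∧
      0 ≤ g (X s) := fun s hs => by
    rw [interior_Icc] at hs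
    have h0 : 0 < s := ha.trans_lt hs.1
    exact ⟨h.hasDerivAt_area h0 (mem_timeInterval_of_le hb h0.le hs.2.le).2 (hg s hs).1,
      (hg s hs).2⟩
  refine monotoneOn_of_deriv_nonneg (convex_Icc a b) (h.continuousOn_area.mono fun s hs =>
    mem_timeInterval_of_le hb (ha.trans hs.1) hs.2) ?_ ?_
  · exact fun s hs => (hd s hs).1.differentiableAt.differentiableWithinAt
  · intro s hs
    rw [(hd s hs).1.deriv]
    exact (hd s hs).2

/-- The area stays positive along the Jiang-Pan flow: it increases where it is small. -/
theorem area_pos_of_gJP (h : IsClassicalSolution gJP T X) (hA : 0 < area (X 0)) {t : ℝ}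
    (ht : t ∈ timeInterval T) : 0 < area (X t) := by
  by_contra! hneg
  have hsub : Set.Icc 0 t ⊆ timeInterval T := fun s hs => mem_timeInterval_of_le ht hs.1 hs.2
  have hcA := h.continuousOn_area.mono hsub
  have hclosed : IsClosed (Set.Icc 0 t ∩ (fun s => area (X s)) ⁻¹' Set.Iic 0) :=
    hcA.preimage_isClosed_of_isClosed isClosed_Icc isClosed_Iic
  -- `b` is the first time at which the area is not positive.
  obtain ⟨b, ⟨hb, hbA⟩, hmin⟩ :=
    (isCompact_Icc.of_isClosed_subset hclosed Set.inter_subset_left).exists_isLeast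
      ⟨t, Set.right_mem_Icc.2 ht.1, hneg⟩
  have hpos : ∀ s, 0 ≤ s → s < b → 0 < area (X s) := fun s hs hsb => by
    by_contra! hsA
    exact absurd (hmin ⟨⟨hs, hsb.le.trans hb.2⟩, hsA⟩) (not_le.2 hsb)
  have hb0 : 0 < b := hb.1.lt_of_ne fun h0 => by
    rw [← h0] at hbA
    exact absurd hA (not_lt.2 hbA)
  have hbS := hsub hb
  have hnhds := mem_nhds_timeInterval hb0 hbS.2
  have hcont : ContinuousAt
      (fun s => length (X s) ^ 2 - 2 * area (X s) * totalCurvature (X 0)) b :=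
    ((h.continuousOn_length.continuousAt hnhds).pow 2).sub
      ((continuousAt_const.mul (h.continuousOn_area.continuousAt hnhds)).mul continuousAt_const)
  have hbA0 : area (X b) = 0 := by
    refine le_antisymm hbA ?_
    have hev : ∀ᶠ s in 𝓝[<] b, 0 ≤ area (X s) := by
      filter_upwards [self_mem_nhdsWithin, nhdsWithin_le_nhds (lt_mem_nhds hb0)] with s hs hs0
      exact (hpos s hs0.le hs).le
    exact ge_of_tendsto ((h.continuousOn_area.continuousAt hnhds).tendsto.mono_left
      nhdsWithin_le_nhds) hev
  have hval : 0 < length (X b) ^ 2 - 2 * area (X b) * totalCurvature (X 0) := by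
    rw [hbA0]
    simpa using pow_pos (h.length_pos hbS) 2
  obtain ⟨ε, hε, hball⟩ := Metric.eventually_nhds_iff_ball.1 (hcont.eventually_const_lt hval)
  -- On `(a, b)` both `A` and `L² - 2 A K` are positive, hence so is their ratio `2 g`. The area is
  -- then nondecreasing up to `b`, contradicting `0 < A(a)` and `A(b) = 0`.
  obtain ⟨a, ha, hab⟩ := exists_between (max_lt hb0 (sub_lt_self b hε))
  have ha0 : 0 < a := (le_max_left _ _).trans_lt ha
  have haε : b - ε < a := (le_max_right _ _).trans_lt ha
  have hmono := h.monotoneOn_area ha0.le hbS fun s hs => by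
    have hs0 : 0 < s := ha0.trans hs.1
    have hsA := hpos s hs0.le hs.2
    have hsS := mem_timeInterval_of_le hbS hs0.le hs.2.le
    refine ⟨h.continuousAt_gJP hs0 hsS.2 hsA.ne', ?_⟩
    have h1 : 0 < length (X s) ^ 2 - 2 * area (X s) * totalCurvature (X 0) := hball s (by
      rw [Metric.mem_ball, Real.dist_eq, abs_lt]
      constructor <;> linarith [hs.1, hs.2])
    rw [gJP, h.totalCurvature_eq_of_zero hsS, sub_nonneg, le_div_iff₀ (by positivity)]
    linarith
  have hle : area (X a) ≤ area (X b) :=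
    hmono (Set.left_mem_Icc.2 hab.le) (Set.right_mem_Icc.2 hab.le) hab.le
  exact absurd (hpos a ha0.le hab) (not_lt.2 (hle.trans hbA))

theorem area_eq_of_gAP (h : IsClassicalSolution gAP T X) {t : ℝ} (ht : t ∈ timeInterval T) :
    area (X t) = area (X 0) := by
  have hg : ∀ s ∈ Set.Ioo 0 t, ContinuousAt (fun s => gAP (X s)) s ∧ 0 ≤ gAP (X s) :=
    fun s _ => ⟨continuousAt_gAP s, le_rfl⟩
  have h0 := Set.left_mem_Icc.2 ht.1
  have h1 := Set.right_mem_Icc.2 ht.1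
  have hd : ∀ s ∈ interior (Set.Icc 0 t), HasDerivAt (fun s => area (X s)) 0 s := fun s hs => by
    rw [interior_Icc] at hs
    exact h.hasDerivAt_area hs.1 (mem_timeInterval_of_le ht hs.1.le hs.2.le).2 (hg s hs).1
  refine le_antisymm (antitoneOn_of_deriv_nonpos (convex_Icc 0 t) (h.continuousOn_area.mono
    fun s hs => mem_timeInterval_of_le ht hs.1 hs.2) (fun s hs =>
      (hd s hs).differentiableAt.differentiableWithinAt) (fun s hs => (hd s hs).deriv.le)
      h0 h1 ht.1) (h.monotoneOn_area le_rfl ht hg h0 h1 ht.1)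

theorem gLP_nonneg {γ : ℝ → ℂ} (hL : 0 ≤ length γ) (hK : 0 ≤ totalCurvature γ) : 0 ≤ gLP γ :=
  mul_nonneg (mul_nonneg hL (inv_nonneg.2 hK)) (arcIntegral_sq_nonneg _ _)

theorem area_le_of_gLP (h : IsClassicalSolution gLP T X) (hK : 0 < totalCurvature (X 0)) {t : ℝ}
    (ht : t ∈ timeInterval T) : area (X 0) ≤ area (X t) := by
  refine h.monotoneOn_area le_rfl ht (fun s hs => ?_) (Set.left_mem_Icc.2 ht.1)
    (Set.right_mem_Icc.2 ht.1) ht.1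
  have hsS := mem_timeInterval_of_le ht hs.1.le hs.2.le
  have hKs : 0 < totalCurvature (X s) := by rwa [h.totalCurvature_eq_of_zero hsS]
  exact ⟨h.continuousAt_gLP hs.1 hsS.2 hKs.ne', gLP_nonneg (h.length_pos hsS).le hKs.le⟩

/-- The isoperimetric deficit decreases along the area-preserving flow. -/
theorem exists_hasDerivAt_isoDeficit_nonpos_of_gAP (h : IsClassicalSolution gAP T X) {n t : ℝ}
    (hrot : rotationNumber (X 0) = n) (hn : 0 < n) (hA : 0 < area (X 0)) (h0 : 0 < t)
    (hT : (t : EReal) < T) : ∃ d ≤ 0, HasDerivAt (fun s => isoDeficit (X s)) d t := by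
  have htS : t ∈ timeInterval T := ⟨h0.le, hT⟩
  refine h.hasDerivAt_isoDeficit_nonpos hrot hn.le h0 hT (continuousAt_gAP t) ?_
  have hE := arcIntegral_sq_nonneg (X t) (curvatureDev (X t))
  have hL := h.length_pos htS
  rw [h.area_eq_of_gAP htS, gAP, zero_mul, zero_add]
  positivity

/-- The isoperimetric deficit decreases along the length-preserving flow. -/
theorem exists_hasDerivAt_isoDeficit_nonpos_of_gLP (h : IsClassicalSolution gLP T X) {n t : ℝ}
    (hrot : rotationNumber (X 0) = n) (hn : 0 < n) (h0 : 0 < t)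
    (hT : (t : EReal) < T) : ∃ d ≤ 0, HasDerivAt (fun s => isoDeficit (X s)) d t := by
  have htS : t ∈ timeInterval T := ⟨h0.le, hT⟩
  have hK : 0 < totalCurvature (X t) := by
    rw [h.totalCurvature_eq_two_pi_mul hrot htS]; positivity
  refine h.hasDerivAt_isoDeficit_nonpos hrot hn.le h0 hT (h.continuousAt_gLP h0 hT hK.ne') ?_
  have hE := arcIntegral_sq_nonneg (X t) (curvatureDev (X t))
  have hL := h.length_pos htS
  rw [gLP]
  generalize arcIntegral (X t) (fun u => curvatureDev (X t) u ^ 2) = E at *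
  -- With `g = L E / K` the term `-2 A K g` cancels `2 A L E`, leaving `g L²`.
  have : 0 ≤ length (X t) ^ 3 * E / totalCurvature (X t) := by positivity
  refine this.trans_eq ?_
  field_simp
  ring

/-- The isoperimetric deficit decreases along the Jiang-Pan flow. -/
theorem exists_hasDerivAt_isoDeficit_nonpos_of_gJP (h : IsClassicalSolution gJP T X) {n t : ℝ}
    (hrot : rotationNumber (X 0) = n) (hn : 0 < n) (hA : 0 < area (X 0)) (h0 : 0 < t)
    (hT : (t : EReal) < T) : ∃ d ≤ 0, HasDerivAt (fun s => isoDeficit (X s)) d t := by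
  have htS : t ∈ timeInterval T := ⟨h0.le, hT⟩
  have hAt := h.area_pos_of_gJP hA htS
  refine h.hasDerivAt_isoDeficit_nonpos hrot hn.le h0 hT (h.continuousAt_gJP h0 hT hAt.ne') ?_
  have hE := arcIntegral_sq_nonneg (X t) (curvatureDev (X t))
  have hL := h.length_pos htS
  refine add_nonneg ?_ (by positivity)
  -- Here `g = (L² - 2 A K) / (2 A)`, so its product with `L² - 2 A K` is a square over `2 A`.
  have : 0 ≤ (length (X t) ^ 2 - 2 * area (X t) * totalCurvature (X t)) ^ 2 / (2 * area (X t)) := by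
    positivity
  refine this.trans_eq ?_
  rw [gJP]
  field_simp

end IsClassicalSolution

end PlaneCurve

theorem mainTheorem9 (T : EReal) (X : ℝ → ℝ → ℂ) (n : ℕ) (hT : 0 < T) (hn : 1 ≤ n)
    (hsmooth : ContDiff ℝ ∞ (X 0)) (hrot : rotationNumber (X 0) = n) (hA : 0 < area (X 0)) :
    -- the area-preserving flow
    (IsClassicalSolution gAP T X → ∀ t : ℝ, 0 < t → (t : EReal) < T →
      HasDerivAt (fun t' => area (X t')) 0 t ∧
      (area (X t) = area (X 0) ∧ 0 < area (X t)) ∧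
      (∃ d ≤ 0, HasDerivAt (fun t' => length (X t') ^ 2) d t) ∧
      (∃ d ≤ 0, HasDerivAt (fun t' => isoDeficit (X t')) d t)) ∧
    -- the length-preserving flow
    (IsClassicalSolution gLP T X → ∀ t : ℝ, 0 < t → (t : EReal) < T →
      (∃ d ≥ 0, HasDerivAt (fun t' => area (X t')) d t) ∧
      (area (X 0) ≤ area (X t) ∧ 0 < area (X t)) ∧
      HasDerivAt (fun t' => length (X t') ^ 2) 0 t ∧
      (∃ d ≤ 0, HasDerivAt (fun t' => isoDeficit (X t')) d t)) ∧
    -- the Jiang-Pan flow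
    (IsClassicalSolution gJP T X → ∀ t : ℝ, 0 < t → (t : EReal) < T →
      0 < area (X t) ∧
      (∃ d ≤ 0, HasDerivAt (fun t' => isoDeficit (X t')) d t)) ∧
    -- all three flows
    (IsClassicalSolution gAP T X ∨ IsClassicalSolution gLP T X ∨ IsClassicalSolution gJP T X →
      ∀ t : ℝ, 0 < t → (t : EReal) < T →
      (1 - (n : ℝ) ≤ isoDeficit (X t) ∧ isoDeficit (X t) ≤ isoDeficit (X 0)) ∧
      (4 * Real.pi ≤ length (X t) ^ 2 / area (X t) ∧
        length (X t) ^ 2 / area (X t) ≤ length (X 0) ^ 2 / area (X 0))) := by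
  have hn' : (0 : ℝ) < n := by exact_mod_cast hn
  have hK : 0 < totalCurvature (X 0) := by
    have h : totalCurvature (X 0) = 2 * Real.pi * n := by
      rw [← hrot, rotationNumber]
      have := Real.pi_ne_zero
      field_simp
    rw [h]; positivity
  refine ⟨fun h t h0 ht => ?_, fun h t h0 ht => ?_, fun h t h0 ht => ?_, ?_⟩
  · have htS : t ∈ timeInterval T := ⟨h0.le, ht⟩
    have hc := IsClassicalSolution.continuousAt_gAP (X := X) t
    have hareaT := h.area_eq_of_gAP htS
    refine ⟨h.hasDerivAt_area h0 ht hc, ⟨hareaT, hareaT ▸ hA⟩,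
      ⟨_, ?_, h.hasDerivAt_length_sq h0 ht hc⟩, h.exists_hasDerivAt_isoDeficit_nonpos_of_gAP hrot hn' hA h0 ht⟩
    have hE := mul_nonneg (h.length_pos htS).le
      (arcIntegral_sq_nonneg (X t) (curvatureDev (X t)))
    rw [gAP, zero_mul, zero_sub]
    linarith
  · have htS : t ∈ timeInterval T := ⟨h0.le, ht⟩
    have hKt : 0 < totalCurvature (X t) := by rwa [h.totalCurvature_eq_of_zero htS]
    have hc := h.continuousAt_gLP h0 ht hKt.ne'
    have hle := h.area_le_of_gLP hK htS
    refine ⟨⟨_, IsClassicalSolution.gLP_nonneg (h.length_pos htS).le hKt.le,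
      h.hasDerivAt_area h0 ht hc⟩, ⟨hle, hA.trans_le hle⟩,
      (h.hasDerivAt_length_sq h0 ht hc).congr_deriv ?_,
      h.exists_hasDerivAt_isoDeficit_nonpos_of_gLP hrot hn' h0 ht⟩
    -- The (LP) term is the one with `g K = L E`, which makes the derivative of `L²` vanish.
    rw [gLP]
    field_simp
    ring
  · exact ⟨h.area_pos_of_gJP hA ⟨h0.le, ht⟩, h.exists_hasDerivAt_isoDeficit_nonpos_of_gJP hrot hn' hA h0 ht⟩
  · rintro (h | h | h) t h0 ht
    · exact h.isoDeficit_bounds hrot hn' (fun s hs => (h.area_eq_of_gAP hs).symm ▸ hA)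
        (fun s hs hsT => h.exists_hasDerivAt_isoDeficit_nonpos_of_gAP hrot hn' hA hs hsT) ⟨h0.le, ht⟩
    · exact h.isoDeficit_bounds hrot hn' (fun s hs => hA.trans_le (h.area_le_of_gLP hK hs))
        (fun s hs hsT => h.exists_hasDerivAt_isoDeficit_nonpos_of_gLP hrot hn' hs hsT) ⟨h0.le, ht⟩
    · exact h.isoDeficit_bounds hrot hn' (fun s hs => h.area_pos_of_gJP hA hs)
        (fun s hs hsT => h.exists_hasDerivAt_isoDeficit_nonpos_of_gJP hrot hn' hA hs hsT) ⟨h0.le, ht⟩
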